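/- For all integers $k \ge 2$ and $g \ge 1$ there is a finite simple graph $G$ with girth at least $g$ that is not $k$-colorable and has maximum average degree at most $2(k-1)$. Here the girth of $G$ is the length of a shortest cycle in $G$, and the maximum average degree of $G$ is $$\max_{H\subseteq G}\frac{\sum_{v\in V(H)}d_H(v)}{|V(H)|},$$ the maximum being over all subgraphs $H$ of $G$ with at least one vertex. -/

import Mathlib

namespace SimpleGraph

open Classical in
/-- The average degree `(∑ v ∈ V(H), d_H(v)) / |V(H)|` of a subgraph `H` of a finite graph. -/
noncomputable def Subgraph.averageDegree {V : Type*} [Fintype V] {G : SimpleGraph V}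
    (H : G.Subgraph) : ℝ :=
  (∑ v ∈ H.verts.toFinset, (H.degree v : ℝ)) / (H.verts.toFinset.card : ℝ)

/-- The maximum average degree of a finite graph: the maximum of the average degrees of its
subgraphs (not necessarily induced) having at least one vertex. There are finitely many
subgraphs, so the supremum is attained when the graph has a vertex. -/
noncomputable def maxAverageDegree {V : Type*} [Fintype V] (G : SimpleGraph V) : ℝ :=
  ⨆ H : {H : G.Subgraph // H.verts.Nonempty}, H.1.averageDegree

/-- The supremum in the definition is a genuine maximum. -/
theorem isGreatest_maxAverageDegree {V : Type*} [Fintype V] [Nonempty V] (G : SimpleGraph V) :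
    IsGreatest {a : ℝ | ∃ H : G.Subgraph, H.verts.Nonempty ∧ H.averageDegree = a}
      G.maxAverageDegree := by
  have : Nonempty {H : G.Subgraph // H.verts.Nonempty} := ⟨⟨⊤, Set.univ_nonempty⟩⟩
  constructor
  · obtain ⟨H, hH⟩ := exists_eq_ciSup_of_finite
      (f := fun H : {H : G.Subgraph // H.verts.Nonempty} => H.1.averageDegree)
    exact ⟨H.1, H.2, hH⟩
  · rintro _ ⟨H, hH, rfl⟩
    exact le_ciSup (f := fun H : {H : G.Subgraph // H.verts.Nonempty} => H.1.averageDegree)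
      (Set.finite_range _).bddAbove ⟨H, hH⟩

end SimpleGraph

/-! Highly chromatic hypergraphs and graphs of large girth, by amalgamation.

A hypergraph is given by labelled edges `φ : E → X → Y`, the edge `e` having the vertices `φ e x`.
Its girth is measured by cores: finite nonempty sets of incidences without leaves. -/

/-! The graph is built by the induction of Tutte and Descartes on the number of colours, starting
from odd cycles. Hang a pendant edge at every vertex of a graph `G` that is not `(k -
1)`-colourable, and glue one copy, along its leaves, to each edge of a hypergraph all of whose
`k`-colourings have a monochromatic edge. If that edge has colour `q`, the pendant edges of a proper
colouring forbid `q` on the copy of `G`, leaving only `k - 1` colours for it.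

For sparsity, orient every pendant edge away from `G`: out-degrees grow by one per round, so they
are at most `k - 1` in the end, and every subgraph `H` has at most `(k - 1) * |V(H)|` edges.

The hypergraphs come from the partite construction (`exists_partite`), each use of which doubles the
girth bound. Both gluings keep the girth large by `GirthGE.amalgam`. -/

namespace LabelledHypergraph

/-! ### Cores, girth and amalgamation. -/

/-- A nonempty finite set of incidences in which every edge and every vertex (the values of `α`
and `β`) that occurs does so at least twice. -/
def IsCore {I A B : Type} (α : I → A) (β : I → B) (T : Finset I) : Prop :=
  T.Nonempty ∧ ∀ i ∈ T, (∃ j ∈ T, j ≠ i ∧ α j = α i) ∧ ∃ j ∈ T, j ≠ i ∧ β j = β i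

theorem IsCore.swap {I A B : Type} {α : I → A} {β : I → B} {T : Finset I} (h : IsCore α β T) :
    IsCore β α T :=
  ⟨h.1, fun i hi => (h.2 i hi).symm⟩

/-- A nonempty set of incidences with at most one leaf contains a core. -/
theorem exists_isCore_subset {I : Type} (T : Finset I) :
    ∀ {A B : Type} (α : I → A) (β : I → B) (v : B), T.Nonempty →
      (∀ i ∈ T, ∃ j ∈ T, j ≠ i ∧ α j = α i) →
      (∀ i ∈ T, β i ≠ v → ∃ j ∈ T, j ≠ i ∧ β j = β i) →
      ∃ S ⊆ T, IsCore α β S := by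
  classical
  induction T using Finset.strongInduction with
  | H T ih =>
    intro A B α β v hT hα hβ
    by_cases hcore : ∀ i ∈ T, ∃ j ∈ T, j ≠ i ∧ β j = β i
    · exact ⟨T, subset_rfl, hT, fun i hi => ⟨hα i hi, hcore i hi⟩⟩
    push Not at hcore
    obtain ⟨i, hi, hleaf⟩ := hcore
    have hiv : β i = v := by
      by_contra h
      obtain ⟨j, hj, hji, hjb⟩ := hβ i hi h
      exact hleaf j hj hji hjb
    subst hiv
    -- Deleting the leaf `i` can make only its edge `α i` a leaf, so induction applies with edges
    -- and vertices interchanged.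
    obtain ⟨S, hS, hSc⟩ := ih (T.erase i) (Finset.erase_ssubset hi) β α (α i)
      (by
        obtain ⟨j, hj, hji, -⟩ := hα i hi
        exact ⟨j, Finset.mem_erase.2 ⟨hji, hj⟩⟩)
      (by
        intro j hj
        obtain ⟨hji, hj⟩ := Finset.mem_erase.1 hj
        obtain ⟨l, hl, hlj, hlb⟩ := hβ j hj (hleaf j hj hji)
        exact ⟨l, Finset.mem_erase.2 ⟨fun h => hleaf j hj hji (h ▸ hlb.symm), hl⟩, hlj, hlb⟩)
      (by
        intro j hj hja
        obtain ⟨hji, hj⟩ := Finset.mem_erase.1 hj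
        obtain ⟨l, hl, hlj, hla⟩ := hα j hj
        refine ⟨l, Finset.mem_erase.2 ⟨?_, hl⟩, hlj, hla⟩
        rintro rfl
        exact hja hla.symm)
    exact ⟨S, hS.trans (Finset.erase_subset _ _), hSc.swap⟩

/-- Every core of the hypergraph `φ` has at least `n` incidences. A cycle with `l` edges has a core
with `2 * l` incidences. -/
def GirthGE {E X Y : Type} (φ : E → X → Y) (n : ℕ) : Prop :=
  ∀ T : Finset (E × X), IsCore Prod.fst (fun i : E × X => φ i.1 i.2) T → n ≤ T.card

open Classical in
/-- The embedding of the copy with index `e` of `V` into the amalgam, where the set `p` is glued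
to the edge `e` of `φ`. -/
noncomputable def glue {E V Y : Type} (p : V → Prop) (φ : E → {v // p v} → Y) (e : E) (v : V) :
    Y ⊕ (E × V) :=
  if h : p v then Sum.inl (φ e ⟨v, h⟩) else Sum.inr (e, v)

theorem glue_of_pos {E V Y : Type} {p : V → Prop} (φ : E → {v // p v} → Y) (e : E) {v : V}
    (h : p v) : glue p φ e v = Sum.inl (φ e ⟨v, h⟩) := dif_pos h

theorem glue_of_neg {E V Y : Type} {p : V → Prop} (φ : E → {v // p v} → Y) (e : E) {v : V}
    (h : ¬ p v) : glue p φ e v = Sum.inr (e, v) := dif_neg h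

/-- The amalgam: one copy of `P` for every edge of `φ`, the vertices in `p` being identified with
those of the edge. -/
noncomputable def amalgam {E F R V Y : Type} (P : F → R → V) (p : V → Prop)
    (φ : E → {v // p v} → Y) (a : E × F) (r : R) : Y ⊕ (E × V) :=
  glue p φ a.1 (P a.2 r)

/-- If every edge of `P` meets `p` at most once, the amalgam has girth at least that of `P` or
twice that of `φ`. -/
theorem GirthGE.amalgam {E F R V Y : Type} {P : F → R → V} {p : V → Prop}
    {φ : E → {v // p v} → Y} {n : ℕ} (hP : GirthGE P (2 * n)) (hφ : GirthGE φ n)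
    (hp : ∀ f r r', p (P f r) → p (P f r') → r = r') :
    GirthGE (amalgam P p φ) (2 * n) := by
  classical
  intro S hS
  obtain ⟨⟨⟨⟨e₀, f₀⟩, r₀⟩, h₀⟩, hS⟩ := hS
  let touched : E × {v // p v} → Prop := fun u => ∃ f r, ((u.1, f), r) ∈ S ∧ P f r = u.2
  let shared : E × {v // p v} → Prop := fun u =>
    touched u ∧ ∃ u', touched u' ∧ u' ≠ u ∧ φ u'.1 u'.2 = φ u.1 u.2
  -- Either some copy met by `S` has at most one shared vertex, and its part of `S`, having at most
  -- one leaf, contains a core of `P`; or every copy met has two, and the shared incidences form a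
  -- core of `φ`.
  by_cases hex : ∃ e v, (∃ f r, ((e, f), r) ∈ S) ∧ ∀ x, shared (e, x) → (x : V) = v
  · obtain ⟨e, v, ⟨f₁, r₁, h₁⟩, hv⟩ := hex
    let Se : Finset (F × R) := (S.filter fun i => i.1.1 = e).image fun i => (i.1.2, i.2)
    have mem_Se : ∀ f r, (f, r) ∈ Se ↔ ((e, f), r) ∈ S := by
      intro f r
      simp only [Se, Finset.mem_image, Finset.mem_filter, Prod.mk.injEq]
      constructor
      · rintro ⟨⟨⟨e', f'⟩, r'⟩, ⟨h, rfl⟩, rfl, rfl⟩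
        exact h
      · exact fun h => ⟨((e, f), r), ⟨h, rfl⟩, rfl, rfl⟩
    obtain ⟨T, hT, hTc⟩ := exists_isCore_subset Se Prod.fst (fun i : F × R => P i.1 i.2) v
      ⟨(f₁, r₁), (mem_Se _ _).2 h₁⟩
      (by
        rintro ⟨f, r⟩ h
        obtain ⟨⟨⟨⟨e', f'⟩, r'⟩, hj, hne, heq⟩, -⟩ := hS _ ((mem_Se _ _).1 h)
        simp only [Prod.mk.injEq] at heq
        obtain ⟨rfl, rfl⟩ := heq
        refine ⟨(f', r'), (mem_Se _ _).2 hj, ?_, rfl⟩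
        rintro ⟨⟩
        exact hne rfl)
      (by
        rintro ⟨f, r⟩ h hne
        have hfr := (mem_Se _ _).1 h
        obtain ⟨-, ⟨⟨e', f'⟩, r'⟩, hj, hji, heq⟩ := hS _ hfr
        simp only [LabelledHypergraph.amalgam] at heq hne
        by_cases h1 : p (P f r)
        · by_cases h2 : p (P f' r')
          · rw [glue_of_pos _ _ h1, glue_of_pos _ _ h2, Sum.inl.injEq] at heq
            by_cases h3 : (e', (⟨P f' r', h2⟩ : {v // p v})) = (e, ⟨P f r, h1⟩)
            · simp only [Prod.mk.injEq, Subtype.mk.injEq] at h3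
              obtain ⟨rfl, h3⟩ := h3
              refine ⟨(f', r'), (mem_Se _ _).2 hj, ?_, h3⟩
              rintro ⟨⟩
              exact hji rfl
            · exact absurd (hv ⟨P f r, h1⟩ ⟨⟨f, r, hfr, rfl⟩, _, ⟨f', r', hj, rfl⟩, h3, heq⟩) hne
          · rw [glue_of_pos _ _ h1, glue_of_neg _ _ h2] at heq
            cases heq
        · by_cases h2 : p (P f' r')
          · rw [glue_of_neg _ _ h1, glue_of_pos _ _ h2] at heq
            cases heq
          · rw [glue_of_neg _ _ h1, glue_of_neg _ _ h2] at heq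
            simp only [Sum.inr.injEq, Prod.mk.injEq] at heq
            obtain ⟨rfl, h3⟩ := heq
            refine ⟨(f', r'), (mem_Se _ _).2 hj, ?_, h3⟩
            rintro ⟨⟩
            exact hji rfl)
    calc 2 * n ≤ T.card := hP T hTc
      _ ≤ Se.card := Finset.card_le_card hT
      _ ≤ (S.filter fun i => i.1.1 = e).card := Finset.card_image_le
      _ ≤ S.card := Finset.card_filter_le _ _
  · push Not at hex
    have hchoose : ∀ u, touched u → ∃ f r r', ((u.1, f), r) ∈ S ∧ P f r = u.2 ∧
        ((u.1, f), r') ∈ S ∧ r' ≠ r := by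
      rintro ⟨e, x⟩ ⟨f, r, h, hx⟩
      obtain ⟨⟨⟨⟨e', f'⟩, r'⟩, hj, hne, heq⟩, -⟩ := hS _ h
      simp only [Prod.mk.injEq] at heq
      obtain ⟨rfl, rfl⟩ := heq
      refine ⟨f', r, r', h, hx, hj, ?_⟩
      rintro rfl
      exact hne rfl
    let U : Finset (E × {v // p v}) :=
      S.biUnion fun i => if h : p (P i.1.2 i.2) then {(i.1.1, ⟨_, h⟩)} else ∅
    have mem_U : ∀ u, u ∈ U ↔ touched u := by
      rintro ⟨e, x, hx⟩
      simp only [U, Finset.mem_biUnion]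
      constructor
      · rintro ⟨⟨⟨e', f⟩, r⟩, h, h'⟩
        split_ifs at h' with hpr
        · simp only [Finset.mem_singleton, Prod.mk.injEq, Subtype.mk.injEq] at h'
          obtain ⟨rfl, rfl⟩ := h'
          exact ⟨f, r, h, rfl⟩
        · simp at h'
      · rintro ⟨f, r, h, hfr⟩
        simp only at hfr h
        subst hfr
        exact ⟨_, h, by simp [hx]⟩
    let T := U.filter shared
    have mem_T : ∀ u, u ∈ T ↔ shared u := fun u => by
      simp only [T, Finset.mem_filter, mem_U]
      exact ⟨fun h => h.2, fun h => ⟨h.1, h⟩⟩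
    have hT : IsCore Prod.fst (fun i : E × {v // p v} => φ i.1 i.2) T := by
      constructor
      · obtain ⟨x, hx, -⟩ := hex e₀ (P f₀ r₀) ⟨f₀, r₀, h₀⟩
        exact ⟨_, (mem_T _).2 hx⟩
      · rintro ⟨e, x⟩ hu
        have hu' := (mem_T _).1 hu
        constructor
        · obtain ⟨f, r, h, -⟩ := hu'.1
          obtain ⟨x', hx', hne⟩ := hex e x ⟨f, r, h⟩
          refine ⟨(e, x'), (mem_T _).2 hx', ?_, rfl⟩
          rintro ⟨⟩
          exact hne rfl
        · obtain ⟨ht, u', ht', hne, heq⟩ := hu'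
          exact ⟨u', (mem_T _).2 ⟨ht', _, ht, hne.symm, heq.symm⟩, hne, heq⟩
    have : Nonempty F := ⟨f₀⟩
    have : Nonempty R := ⟨r₀⟩
    choose! f r r' h1 h2 h3 h4 using hchoose
    have hpr : ∀ u, touched u → p (P (f u) (r u)) := fun u hu => by
      rw [h2 u hu]
      exact u.2.2
    have hT' : ∀ u ∈ T, touched u := fun u hu => ((mem_T u).1 hu).1
    -- Each shared incidence yields two incidences of `S` on one edge of its copy. That edge meets
    -- `p` only once, so no incidence is counted twice.
    let a : E × {v // p v} → (E × F) × R := fun u => ((u.1, f u), r u)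
    let b : E × {v // p v} → (E × F) × R := fun u => ((u.1, f u), r' u)
    have hedge : ∀ u ∈ T, ∀ w ∈ T, u.1 = w.1 → f u = f w → u = w := by
      intro u hu w hw he hf
      have hr : r u = r w := hp (f u) _ _ (hpr u (hT' u hu)) (hf ▸ hpr w (hT' w hw))
      refine Prod.ext he (Subtype.ext ?_)
      rw [← h2 u (hT' u hu), ← h2 w (hT' w hw), hf, hr]
    have ha : Set.InjOn a T := by
      intro u hu w hw h
      simp only [a, Prod.mk.injEq] at h
      exact hedge u hu w hw h.1.1 h.1.2
    have hb : Set.InjOn b T := by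
      intro u hu w hw h
      simp only [b, Prod.mk.injEq] at h
      exact hedge u hu w hw h.1.1 h.1.2
    have hdisj : Disjoint (T.image a) (T.image b) := by
      rw [Finset.disjoint_left]
      rintro i hi hi'
      obtain ⟨u, hu, rfl⟩ := Finset.mem_image.1 hi
      obtain ⟨w, hw, h⟩ := Finset.mem_image.1 hi'
      simp only [a, b, Prod.mk.injEq] at h
      obtain rfl := hedge w hw u hu h.1.1 h.1.2
      exact h4 _ (hT' _ hu) h.2
    have hsub : T.image a ∪ T.image b ⊆ S := by
      apply Finset.union_subset
      · intro i hi
        obtain ⟨u, hu, rfl⟩ := Finset.mem_image.1 hi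
        exact h1 u (hT' u hu)
      · intro i hi
        obtain ⟨u, hu, rfl⟩ := Finset.mem_image.1 hi
        exact h3 u (hT' u hu)
    calc 2 * n ≤ 2 * T.card := Nat.mul_le_mul_left _ (hφ T hT)
      _ = (T.image a).card + (T.image b).card := by
          rw [Finset.card_image_of_injOn ha, Finset.card_image_of_injOn hb, two_mul]
      _ = (T.image a ∪ T.image b).card := (Finset.card_union_of_disjoint hdisj).symm
      _ ≤ S.card := Finset.card_le_card hsub

/-! ### Ramsey hypergraphs of large girth. -/

/-- Every colouring with colours in `C` has a monochromatic edge. -/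
def Ramsey {E X Y : Type} (φ : E → X → Y) (C : Type) : Prop :=
  ∀ c : Y → C, ∃ e q, ∀ x, c (φ e x) = q

/-- The partite construction: the colour of a vertex of a suitable subsystem depends only on its
part, as far as the part is in `J`. -/
theorem exists_partite {C R A : Type} [Nonempty C] [Finite R] [Finite A] {n : ℕ}
    (H : ∀ X : Type, Finite X → ∃ (E Y : Type) (_ : Finite E) (_ : Finite Y) (φ : E → X → Y),
      GirthGE φ n ∧ Ramsey φ C) (J : Finset A) :
    ∃ (F V : Type) (_ : Finite F) (_ : Finite V) (P : F → R → V) (π : V → A),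
      (∀ f, Function.Injective fun r => π (P f r)) ∧ GirthGE P (2 * n) ∧
      ∀ c : V → C, ∃ d : A → C, ∀ s : R ↪ A, ∃ f, (∀ r, π (P f r) = s r) ∧
        ∀ r, s r ∈ J → c (P f r) = d (s r) := by
  classical
  induction J using Finset.induction_on with
  | empty =>
    -- Pairwise disjoint edges, one for each choice of parts, have no core at all.
    refine ⟨R ↪ A, (R ↪ A) × R, inferInstance, inferInstance, fun f r => (f, r),
      fun v => v.1 v.2, fun f => f.injective, ?_, ?_⟩
    · rintro T ⟨⟨i, hi⟩, hT⟩
      obtain ⟨-, j, -, hne, heq⟩ := hT i hi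
      exact absurd heq hne
    · exact fun c => ⟨fun _ => Classical.arbitrary C, fun s => ⟨s, fun r => rfl, by simp⟩⟩
  | insert i J hi ih =>
    obtain ⟨F, V, _, _, P, π, hπ, hP, hc⟩ := ih
    -- The whole part `i` is glued to the edges of `φ`; a monochromatic edge of `φ` gives a copy of
    -- `P` on which part `i` has one colour.
    obtain ⟨E, Y, _, _, φ, hφ, hR⟩ := H {v // π v = i} inferInstance
    have hglue : ∀ e v, Sum.elim (fun _ => i) (fun a : E × V => π a.2)
        (glue (fun v => π v = i) φ e v) = π v := by
      intro e v
      by_cases h : π v = i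
      · rw [glue_of_pos (p := fun v => π v = i) φ e h, Sum.elim_inl, h]
      · rw [glue_of_neg (p := fun v => π v = i) φ e h, Sum.elim_inr]
    refine ⟨E × F, Y ⊕ (E × V), inferInstance, inferInstance, amalgam P (fun v => π v = i) φ,
      Sum.elim (fun _ => i) (fun a => π a.2), ?_, ?_, ?_⟩
    · rintro ⟨e, f⟩
      simpa only [amalgam, hglue] using hπ f
    · exact hP.amalgam hφ fun f r r' h h' => hπ f (h.trans h'.symm)
    · intro c
      obtain ⟨e, q, hq⟩ := hR fun y => c (Sum.inl y)
      obtain ⟨d, hd⟩ := hc fun v => c (glue (fun v => π v = i) φ e v)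
      refine ⟨Function.update d i q, fun s => ?_⟩
      obtain ⟨f, hf, hfc⟩ := hd s
      refine ⟨(e, f), fun r => (hglue e _).trans (hf r), fun r hr => ?_⟩
      by_cases h : s r = i
      · rw [h, Function.update_self, ← hq ⟨P f r, (hf r).trans h⟩]
        simp only [amalgam]
        rw [glue_of_pos (p := fun v => π v = i)]
      · rw [Function.update_of_ne h]
        exact hfc r ((Finset.mem_insert.1 hr).resolve_left h)

/-- For every number of colours and every uniformity there are hypergraphs of large girth all of
whose colourings have a monochromatic edge. -/
theorem exists_girthGE_ramsey (C : Type) [Finite C] [Nonempty C] (n : ℕ) :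
    ∀ X : Type, Finite X → ∃ (E Y : Type) (_ : Finite E) (_ : Finite Y) (φ : E → X → Y),
      GirthGE φ (2 ^ n) ∧ Ramsey φ C := by
  induction n with
  | zero =>
    exact fun X _ => ⟨Unit, Unit, inferInstance, inferInstance, fun _ _ => (),
      fun T hT => hT.1.card_pos, fun c => ⟨(), c (), fun _ => rfl⟩⟩
  | succ n ih =>
    intro R _
    have := Fintype.ofFinite R
    have := Fintype.ofFinite C
    classical
    -- With `|C| * |R| + 1` parts, more than `|R|` of them receive the same colour from `d`.
    obtain ⟨F, V, hF, hV, P, π, hπ, hP, hc⟩ := exists_partite (R := R)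
      (A := Fin (Fintype.card C * Fintype.card R + 1)) ih Finset.univ
    refine ⟨F, V, hF, hV, P, by rwa [pow_succ'], fun c => ?_⟩
    obtain ⟨d, hd⟩ := hc c
    obtain ⟨q, hq⟩ := Fintype.exists_lt_card_fiber_of_mul_lt_card (n := Fintype.card R) d (by simp)
    obtain ⟨s⟩ : Nonempty (R ↪ {a // d a = q}) := by
      apply Function.Embedding.nonempty_of_card_le
      rw [Fintype.card_subtype]
      exact hq.le
    obtain ⟨f, -, hf⟩ := hd (s.trans (Function.Embedding.subtype _))
    exact ⟨f, q, fun r => (hf r (Finset.mem_univ _)).trans (s r).2⟩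

/-! ### The Tutte–Descartes graphs. -/

theorem exists_oddCycle (n : ℕ) :
    ∃ (F V : Type) (_ : Finite F) (_ : Finite V) (G : F → Bool → V),
      GirthGE G n ∧ (∀ c : V → Fin 2, ∃ f, c (G f false) = c (G f true)) ∧
      ∃ l : F → Fin 1, Function.Injective fun f => (G f false, l f) := by
  classical
  refine ⟨ZMod (2 * n + 1), ZMod (2 * n + 1), inferInstance, inferInstance,
    fun i b => bif b then i + 1 else i, ?_, ?_, fun _ => 0, fun i j h => (Prod.mk.inj h).1⟩
  · rintro T ⟨⟨⟨i, b⟩, hi⟩, hT⟩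
    have hflip : ∀ i b, (i, b) ∈ T → (i, !b) ∈ T := by
      intro i b h
      obtain ⟨⟨⟨j, b'⟩, hj, hne, heq⟩, -⟩ := hT _ h
      simp only at heq
      subst heq
      have : b' = !b := by
        rw [Bool.eq_not]
        rintro rfl
        exact hne rfl
      exact this ▸ hj
    have hall : ∀ i b, (i, b) ∈ T → ∀ b', (i, b') ∈ T := by
      intro i b h b'
      by_cases hb : b' = b
      · exact hb ▸ h
      · rw [Bool.eq_not.2 hb]
        exact hflip i b h
    have hsucc : ∀ i b, (i, b) ∈ T → (i + 1, false) ∈ T := by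
      intro i b h
      obtain ⟨-, ⟨j, b'⟩, hj, hne, heq⟩ := hT _ (hall i b h true)
      cases b'
      · simp only [cond_true, cond_false] at heq
        exact heq ▸ hj
      · simp only [cond_true, add_left_inj] at heq
        exact absurd (by rw [heq]) hne
    have hnat : ∀ m : ℕ, (i + m, false) ∈ T := by
      intro m
      induction m with
      | zero => simpa using hall i b hi false
      | succ m ih => simpa [add_assoc] using hsucc _ _ ih
    -- A core is closed under passing to the next edge of the cycle, so it goes all the way round.
    have hsub : (Finset.univ : Finset (ZMod (2 * n + 1))).image (fun j => (j, false)) ⊆ T := by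
      intro x hx
      obtain ⟨j, -, rfl⟩ := Finset.mem_image.1 hx
      simpa using hnat (j - i).val
    have := Finset.card_le_card hsub
    rw [Finset.card_image_of_injective _ fun x y h => (Prod.mk.inj h).1, Finset.card_univ,
      ZMod.card] at this
    omega
  · intro c
    by_contra! h
    have hne : ∀ i : ZMod (2 * n + 1), c (i + 1) = c i + 1 := by
      intro i
      have := h i
      simp only [cond_true, cond_false] at this
      generalize c i = x at *
      generalize c (i + 1) = y at *
      revert this
      revert x y
      decide
    have hnat : ∀ m : ℕ, c ((2 * m : ℕ) : ZMod (2 * n + 1)) = c 0 := by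
      intro m
      induction m with
      | zero => simp
      | succ m ih =>
        have h2 : ((2 * (m + 1) : ℕ) : ZMod (2 * n + 1)) = (2 * m : ℕ) + 1 + 1 := by
          push_cast
          ring
        rw [h2, hne, hne, ih]
        generalize c 0 = x
        revert x
        decide
    -- Two colours alternate along the cycle, so the step from `2 * n` back to `0` gives `c 0 = c 0
    -- + 1`.
    have hlast := hne (2 * n : ℕ)
    have hz : ((2 * n : ℕ) : ZMod (2 * n + 1)) + 1 = 0 := by
      exact_mod_cast ZMod.natCast_self (2 * n + 1)
    rw [hz, hnat] at hlast
    generalize c 0 = x at hlast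
    revert x
    decide

/-- Adding a pendant edge at every vertex of a graph. -/
def pendant {F V : Type} (G : F → Bool → V) : F ⊕ V → Bool → V ⊕ V :=
  Sum.elim (fun f b => Sum.inl (G f b)) (fun v b => bif b then Sum.inr v else Sum.inl v)

/-- A leaf lies on a single edge, so no pendant edge takes part in a core. -/
theorem GirthGE.pendant {F V : Type} {G : F → Bool → V} {n : ℕ} (hG : GirthGE G n) :
    GirthGE (pendant G) n := by
  classical
  rintro T ⟨hne, hT⟩
  have h1 : ∀ v, (Sum.inr v, true) ∉ T := by
    intro v h
    obtain ⟨-, ⟨f | w, b⟩, -, hne, heq⟩ := hT _ h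
    · simp [LabelledHypergraph.pendant] at heq
    · cases b
      · simp [LabelledHypergraph.pendant] at heq
      · simp only [LabelledHypergraph.pendant, Sum.elim_inr, cond_true, Sum.inr.injEq] at heq
        exact hne (by rw [heq])
  have h2 : ∀ v b, (Sum.inr v, b) ∉ T := by
    intro v b h
    cases b
    · obtain ⟨⟨⟨j, b⟩, hj, hne, heq⟩, -⟩ := hT _ h
      simp only at heq
      subst heq
      cases b
      · exact hne rfl
      · exact h1 v hj
    · exact h1 v h
  let g : F × Bool → (F ⊕ V) × Bool := fun i => (Sum.inl i.1, i.2)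
  have hg : Function.Injective g := by
    rintro ⟨f, b⟩ ⟨f', b'⟩ h
    simpa [g] using h
  have hrange : ∀ i ∈ T, ∃ j, g j = i := by
    rintro ⟨f | v, b⟩ h
    · exact ⟨(f, b), rfl⟩
    · exact absurd h (h2 v b)
  let S : Finset (F × Bool) := T.preimage g hg.injOn
  have mem_S : ∀ i, i ∈ S ↔ g i ∈ T := fun i => Finset.mem_preimage
  have hS : IsCore Prod.fst (fun i : F × Bool => G i.1 i.2) S := by
    constructor
    · obtain ⟨i, hi⟩ := hne
      obtain ⟨j, rfl⟩ := hrange i hi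
      exact ⟨j, (mem_S j).2 hi⟩
    · intro i hi
      obtain ⟨⟨j, hj, hji, heq⟩, ⟨j', hj', hji', heq'⟩⟩ := hT _ ((mem_S i).1 hi)
      obtain ⟨j, rfl⟩ := hrange j hj
      obtain ⟨j', rfl⟩ := hrange j' hj'
      exact ⟨⟨j, (mem_S j).2 hj, fun h => hji (h ▸ rfl), Sum.inl_injective heq⟩,
        ⟨j', (mem_S j').2 hj', fun h => hji' (h ▸ rfl), Sum.inl_injective heq'⟩⟩
  refine (hG S hS).trans ?_
  rw [← Finset.card_image_of_injective S hg]
  apply Finset.card_le_card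
  intro x hx
  obtain ⟨i, hi, rfl⟩ := Finset.mem_image.1 hx
  exact (mem_S i).1 hi

/-- The construction of Tutte and Descartes: a graph of large girth that is not
`(d + 2)`-colourable and has an orientation with out-degrees at most `d + 1`. -/
theorem exists_girthGE_not_colorable (n d : ℕ) :
    ∃ (F V : Type) (_ : Finite F) (_ : Finite V) (G : F → Bool → V),
      GirthGE G (2 * 2 ^ n) ∧ (∀ c : V → Fin (d + 2), ∃ f, c (G f false) = c (G f true)) ∧
      ∃ l : F → Fin (d + 1), Function.Injective fun f => (G f false, l f) := by
  induction d with
  | zero => exact exists_oddCycle _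
  | succ d ih =>
    obtain ⟨F, V, _, _, G, hG, hc, l, hl⟩ := ih
    let p : V ⊕ V → Prop := fun v => v.isRight
    obtain ⟨E, Y, _, _, φ, hφ, hR⟩ :=
      exists_girthGE_ramsey (Fin (d + 1 + 2)) n {v // p v} inferInstance
    refine ⟨E × (F ⊕ V), Y ⊕ (E × (V ⊕ V)), inferInstance, inferInstance,
      -- Old edges keep their labels and pendant edges take the new last one. Glued vertices are
      -- never tails.
      amalgam (pendant G) p φ, ?_, ?_, fun a => Sum.elim (fun f => (l f).castSucc)
        (fun _ => Fin.last _) a.2, ?_⟩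
    · refine hG.pendant.amalgam hφ ?_
      rintro (f | v) (_ | _) (_ | _) <;> simp [p, pendant]
    · intro c
      obtain ⟨e, q, hq⟩ := hR fun y => c (Sum.inl y)
      -- Either some vertex of the copy of `G` has the colour `q` of its leaf, or the copy avoids
      -- `q` and `G` is coloured by the remaining `d + 2` colours.
      by_cases hv : ∃ v, c (Sum.inr (e, Sum.inl v)) = q
      · obtain ⟨v, hv⟩ := hv
        refine ⟨(e, Sum.inr v), ?_⟩
        simp only [amalgam, pendant, Sum.elim_inr, cond_true, cond_false]
        rw [glue_of_neg φ e (by simp [p]), glue_of_pos φ e (by simp [p]), hv, hq]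
      · push Not at hv
        choose c' hc' using fun v => Fin.exists_succAbove_eq (hv v)
        obtain ⟨f, hf⟩ := hc c'
        refine ⟨(e, Sum.inl f), ?_⟩
        simp only [amalgam, pendant, Sum.elim_inl]
        rw [glue_of_neg φ e (by simp [p]), glue_of_neg φ e (by simp [p]), ← hc', ← hc', hf]
    · have htail : ∀ e (f : F ⊕ V), amalgam (pendant G) p φ (e, f) false =
          Sum.inr (e, Sum.inl (Sum.elim (fun f => G f false) id f)) := by
        rintro e (f | v) <;> simp only [amalgam, pendant, Sum.elim_inl, Sum.elim_inr, cond_false]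
        · rw [glue_of_neg φ e (by simp [p])]
        · rw [glue_of_neg φ e (by simp [p])]
          rfl
      rintro ⟨e, f⟩ ⟨e', f'⟩ h
      simp only [htail, Prod.mk.injEq, Sum.inr.injEq, Sum.inl.injEq] at h
      obtain ⟨⟨rfl, h1⟩, h2⟩ := h
      rcases f with f | v <;> rcases f' with f' | v'
      · simp only [Sum.elim_inl, Fin.castSucc_inj] at h1 h2
        rw [hl (Prod.ext h1 h2 : (G f false, l f) = (G f' false, l f'))]
      · exact absurd h2 (Fin.castSucc_lt_last _).ne
      · exact absurd h2 (Fin.castSucc_lt_last _).ne'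
      · simp only [Sum.elim_inr, id] at h1
        rw [h1]

/-! ### From labelled graphs to simple graphs. -/

/-- The simple graph underlying a labelled graph. -/
def toSimpleGraph {F V : Type} (G : F → Bool → V) : SimpleGraph V where
  Adj u v := u ≠ v ∧ ∃ f b, G f b = u ∧ G f (!b) = v
  symm := ⟨fun u v ⟨hne, f, b, hu, hv⟩ => ⟨hne.symm, f, !b, hv, by simpa using hu⟩⟩
  loopless := ⟨fun _ h => h.1 rfl⟩

/-- A loop would be a core with two incidences. -/
theorem GirthGE.ne {F V : Type} {G : F → Bool → V} (hG : GirthGE G 3) (f : F) :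
    G f false ≠ G f true := by
  classical
  intro h
  have hT : IsCore Prod.fst (fun i : F × Bool => G i.1 i.2) {(f, false), (f, true)} := by
    refine ⟨⟨(f, false), by simp⟩, fun i hi => ?_⟩
    simp only [Finset.mem_insert, Finset.mem_singleton] at hi
    rcases hi with rfl | rfl
    · exact ⟨⟨(f, true), by simp⟩, (f, true), by simp [h]⟩
    · exact ⟨⟨(f, false), by simp⟩, (f, false), by simp [h]⟩
  have h1 := hG _ hT
  have h2 := Finset.card_le_two (a := (f, false)) (b := (f, true))
  omega

theorem not_colorable_toSimpleGraph {F V : Type} {G : F → Bool → V} {k : ℕ} (hG : GirthGE G 3)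
    (hc : ∀ c : V → Fin k, ∃ f, c (G f false) = c (G f true)) :
    ¬ (toSimpleGraph G).Colorable k := by
  rintro ⟨c⟩
  obtain ⟨f, hf⟩ := hc c
  exact c.valid (show (toSimpleGraph G).Adj _ _ from ⟨hG.ne f, f, false, rfl, rfl⟩) hf

/-- The degree sum counts ordered adjacent pairs. Such a pair is determined by the tail and label of
an edge together with a direction, and the tail lies in `H`; this leaves `2 * d` pairs per vertex of
`H`. -/
theorem averageDegree_toSimpleGraph_le {F V : Type} [Nonempty F] [Fintype V] {G : F → Bool → V} {d : ℕ}
    {l : F → Fin d} (hl : Function.Injective fun f => (G f false, l f))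
    (H : (toSimpleGraph G).Subgraph) (hH : H.verts.Nonempty) : H.averageDegree ≤ 2 * (d : ℝ) := by
  classical
  have hpos : 0 < H.verts.toFinset.card := Finset.card_pos.2 (Set.toFinset_nonempty.2 hH)
  unfold SimpleGraph.Subgraph.averageDegree
  rw [div_le_iff₀ (by exact_mod_cast hpos)]
  have key : ∑ v ∈ H.verts.toFinset, H.degree v ≤ 2 * d * H.verts.toFinset.card := by
    have h1 : ∀ v, H.degree v = (Finset.univ.filter fun u => H.Adj v u).card := by
      intro v
      rw [← SimpleGraph.Subgraph.finset_card_neighborSet_eq_degree]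
      congr 1
      ext u
      simp
    simp only [h1]
    rw [← Finset.card_sigma]
    have hex : ∀ a : (_ : V) × V, H.Adj a.1 a.2 → ∃ i : F × Bool, G i.1 i.2 = a.1 ∧
        G i.1 (!i.2) = a.2 := by
      rintro ⟨u, v⟩ h
      obtain ⟨-, f, b, hu, hv⟩ := H.adj_sub h
      exact ⟨(f, b), hu, hv⟩
    choose! t ht1 ht2 using hex
    calc _ ≤ (H.verts.toFinset ×ˢ (Finset.univ : Finset (Fin d × Bool))).card := by
          refine Finset.card_le_card_of_injOn
            (fun a => (G (t a).1 false, (l (t a).1, (t a).2))) ?_ ?_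
          · rintro a ha
            have hadj : H.Adj a.1 a.2 := by simpa using (Finset.mem_sigma.1 ha).2
            have : G (t a).1 false ∈ H.verts := by
              have e1 := ht1 a hadj
              have e2 := ht2 a hadj
              cases hb : (t a).2
              · rw [hb] at e1
                exact e1 ▸ H.edge_vert hadj
              · rw [hb] at e2
                exact e2 ▸ H.edge_vert hadj.symm
            simpa using this
          · rintro a ha b hb h
            have hadj : H.Adj a.1 a.2 := by simpa using (Finset.mem_sigma.1 ha).2
            have hadj' : H.Adj b.1 b.2 := by simpa using (Finset.mem_sigma.1 hb).2
            simp only [Prod.mk.injEq] at h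
            have hf : (t a).1 = (t b).1 := hl (Prod.ext h.1 h.2.1)
            have htt : t a = t b := Prod.ext hf h.2.2
            refine Sigma.ext ?_ (heq_of_eq ?_)
            · rw [← ht1 a hadj, ← ht1 b hadj', htt]
            · rw [← ht2 a hadj, ← ht2 b hadj', htt]
      _ = 2 * d * H.verts.toFinset.card := by
          simp only [Finset.card_product, Finset.card_univ, Fintype.card_prod, Fintype.card_fin,
            Fintype.card_bool]
          ring
  have : ((∑ v ∈ H.verts.toFinset, H.degree v : ℕ) : ℝ) ≤
      ((2 * d * H.verts.toFinset.card : ℕ) : ℝ) := Nat.cast_le.2 key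
  push_cast at this
  convert this

/-- Both incidences of every edge of a cycle of length `m` form a core of size `2 * m`, since each
vertex of the cycle has two neighbours on it. -/
theorem le_egirth_toSimpleGraph {F V : Type} [Nonempty F] {G : F → Bool → V} {g : ℕ}
    (hG : GirthGE G (2 * g)) : (g : ℕ∞) ≤ (toSimpleGraph G).egirth := by
  classical
  rw [SimpleGraph.le_egirth]
  intro a w hw
  have hex : ∀ e ∈ w.edges, ∃ f, s(G f false, G f true) = e := by
    intro e he
    have he' := w.edges_subset_edgeSet he
    induction e with | _ u v
    obtain ⟨-, f, b, rfl, rfl⟩ := he'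
    cases b
    · exact ⟨f, rfl⟩
    · exact ⟨f, Sym2.eq_swap⟩
  choose! t ht using hex
  have htb : ∀ e ∈ w.edges, ∀ b, s(G (t e) b, G (t e) (!b)) = e := by
    rintro e he (_ | _)
    · exact ht e he
    · exact Sym2.eq_swap.trans (ht e he)
  have hinj : Set.InjOn t w.edges.toFinset := by
    intro e he e' he' h
    rw [← ht e (List.mem_toFinset.1 he), ← ht e' (List.mem_toFinset.1 he'), h]
  have hT : IsCore Prod.fst (fun i : F × Bool => G i.1 i.2)
      (w.edges.toFinset.image t ×ˢ (Finset.univ : Finset Bool)) := by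
    have mem : ∀ e ∈ w.edges, ∀ b, (t e, b) ∈
        w.edges.toFinset.image t ×ˢ (Finset.univ : Finset Bool) :=
      fun e he b => Finset.mk_mem_product
        (Finset.mem_image_of_mem t (List.mem_toFinset.2 he)) (Finset.mem_univ b)
    constructor
    · obtain ⟨e, he⟩ := List.exists_mem_of_ne_nil w.edges
        fun h => hw.not_nil (SimpleGraph.Walk.edges_eq_nil.1 h)
      exact ⟨_, mem e he false⟩
    · rintro ⟨f, b⟩ hi
      obtain ⟨e, he, rfl⟩ := Finset.mem_image.1 (Finset.mem_product.1 hi).1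
      rw [List.mem_toFinset] at he
      refine ⟨⟨(t e, !b), mem e he _, by simp, rfl⟩, ?_⟩
      have hadj : w.toSubgraph.Adj (G (t e) b) (G (t e) (!b)) := by
        rw [← SimpleGraph.Subgraph.mem_edgeSet, SimpleGraph.Walk.mem_edges_toSubgraph, htb e he]
        exact he
      have htwo := hw.ncard_neighborSet_toSubgraph_eq_two
        ((SimpleGraph.Walk.mem_verts_toSubgraph w).1 hadj.fst_mem)
      obtain ⟨v, hv, hne⟩ := Set.exists_ne_of_one_lt_ncard (htwo ▸ one_lt_two) (G (t e) (!b))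
      have he' : s(G (t e) b, v) ∈ w.edges :=
        (SimpleGraph.Walk.mem_edges_toSubgraph w).1 (SimpleGraph.Subgraph.mem_edgeSet.2 hv)
      have hee : s(G (t e) b, v) ≠ e := by
        conv_rhs => rw [← htb e he b]
        exact fun h => hne (Sym2.congr_right.1 h)
      obtain ⟨b', hb'⟩ : ∃ b', G (t s(G (t e) b, v)) b' = G (t e) b := by
        have hmem : G (t e) b ∈ s(G (t e) b, v) := Sym2.mem_mk_left _ _
        rw [← ht _ he', Sym2.mem_iff] at hmem
        rcases hmem with h | h
        · exact ⟨false, h.symm⟩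
        · exact ⟨true, h.symm⟩
      refine ⟨(t s(G (t e) b, v), b'), mem _ he' _, fun h => hee ?_, hb'⟩
      exact hinj (List.mem_toFinset.2 he') (List.mem_toFinset.2 he) (Prod.mk.inj h).1
  have h := hG _ hT
  rw [Finset.card_product, Finset.card_image_of_injOn hinj,
    List.toFinset_card_of_nodup hw.edges_nodup, SimpleGraph.Walk.length_edges, Finset.card_univ,
    Fintype.card_bool] at h
  exact_mod_cast (by omega : g ≤ w.length)

end LabelledHypergraph

theorem mainTheorem4 (k g : ℕ) (hk : 2 ≤ k) :
    ∃ (V : Type) (_ : Fintype V) (G : SimpleGraph V),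
      (g : ℕ∞) ≤ G.egirth ∧ ¬ G.Colorable k ∧ G.maxAverageDegree ≤ 2 * ((k : ℝ) - 1) := by
  obtain ⟨d, rfl⟩ := Nat.exists_eq_add_of_le' hk
  -- The exponent `g + 1` makes `2 * 2 ^ (g + 1)` at least `2 * g` and, even for `g = 0`, at least
  -- the `3` that excludes loops.
  obtain ⟨F, V, _, _, G, hG, hc, l, hl⟩ := LabelledHypergraph.exists_girthGE_not_colorable (g + 1) d
  have hpow : g + 1 < 2 ^ (g + 1) := Nat.lt_two_pow_self
  have := Fintype.ofFinite V
  have : Nonempty F := ⟨(hc fun _ => 0).choose⟩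
  refine ⟨V, inferInstance, LabelledHypergraph.toSimpleGraph G,
    LabelledHypergraph.le_egirth_toSimpleGraph fun T hT => ?_,
    LabelledHypergraph.not_colorable_toSimpleGraph (fun T hT => ?_) hc, ?_⟩
  · have := hG T hT
    omega
  · have := hG T hT
    omega
  · have : Nonempty V := ⟨G (Classical.arbitrary F) false⟩
    have : Nonempty {H : (LabelledHypergraph.toSimpleGraph G).Subgraph // H.verts.Nonempty} :=
      ⟨⟨⊤, Set.univ_nonempty⟩⟩
    refine ciSup_le fun H => ?_
    have h := LabelledHypergraph.averageDegree_toSimpleGraph_le hl H.1 H.2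
    push_cast at h ⊢
    linarith
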